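/- Let $\mathcal{H}$ be a complex Hilbert space. A linear subspace $\mathcal{S}$ of a Hilbert space $(\mathcal{G},\langle\cdot,\cdot\rangle)$ is called semiclosed if there is an inner product $\langle\cdot,\cdot\rangle'$ on $\mathcal{S}$ such that $(\mathcal{S},\langle\cdot,\cdot\rangle')$ is a Hilbert space and, for some $b>0$, $\langle x,x\rangle\le b\,\langle x,x\rangle'$ for every $x\in\mathcal{S}$. A linear operator $C:\mathcal{D}(C)\to\mathcal{H}$, defined on a linear subspace $\mathcal{D}(C)\subseteq\mathcal{H}$ (not necessarily dense) and possibly unbounded, is called semiclosed if its graph $\{(x,Cx):x\in\mathcal{D}(C)\}$ is a semiclosed subspace of the Hilbert space $\mathcal{H}\times\mathcal{H}$. Let $E:\mathcal{D}(E)\subseteq\mathcal{H}\to\mathcal{H}$ be a projection, i.e. a linear operator, not necessarily bounded or densely defined, such that $\mathcal{R}(E)\subseteq\mathcal{D}(E)$ and $E^2x=Ex$ for every $x\in\mathcal{D}(E)$. Then $E$ is semiclosed if and only if its range $\mathcal{R}(E)=\{Ex:x\in\mathcal{D}(E)\}$ and its nullspace $\mathcal{N}(E)=\{x\in\mathcal{D}(E):Ex=0\}$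 are both semiclosed subspaces of $\mathcal{H}$. -/

import Mathlib

/-- A (not necessarily closed) subspace `S` of an inner product space `G` is *semiclosed* if it
carries an inner product `c` such that `(S, c)` is complete (a Hilbert space) and is continuously
included in `G`: there is `b > 0` with `⟨x, x⟩ = ‖x‖ ^ 2 ≤ b * c(x, x)` for all `x ∈ S`. -/
def IsSemiclosedSubspace {G : Type*} [NormedAddCommGroup G] [InnerProductSpace ℂ G]
    (S : Submodule ℂ G) : Prop :=
  ∃ c : InnerProductSpace.Core ℂ S,
    @CompleteSpace S c.toNormedAddCommGroup.toMetricSpace.toUniformSpace ∧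
    ∃ b : ℝ, 0 < b ∧
      ∀ x : S, ‖(x : G)‖ ^ 2 ≤ b * RCLike.re (c.inner x x)

/-- The graph of a (possibly unbounded) operator `A : D(A) ⊆ H → K`, as a subspace of the Hilbert
space product `H × K`, with inner product `⟨x, x'⟩ + ⟨y, y'⟩`. -/
def operatorGraph {H K : Type*} [NormedAddCommGroup H] [InnerProductSpace ℂ H]
    [NormedAddCommGroup K] [InnerProductSpace ℂ K] (A : H →ₗ.[ℂ] K) :
    Submodule ℂ (WithLp 2 (H × K)) :=
  A.graph.comap (WithLp.linearEquiv 2 ℂ (H × K)).toLinearMap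

/-- An operator is *semiclosed* if its graph is a semiclosed subspace of `H × K`. -/
def IsSemiclosedOperator {H K : Type*} [NormedAddCommGroup H] [InnerProductSpace ℂ H]
    [NormedAddCommGroup K] [InnerProductSpace ℂ K] (A : H →ₗ.[ℂ] K) : Prop :=
  IsSemiclosedSubspace (operatorGraph A)

/-- The range of an operator. -/
def operatorRange {H K : Type*} [NormedAddCommGroup H] [InnerProductSpace ℂ H]
    [NormedAddCommGroup K] [InnerProductSpace ℂ K] (A : H →ₗ.[ℂ] K) : Submodule ℂ K :=
  LinearMap.range A.toFun

/-- The nullspace `{x ∈ D(A) | A x = 0}` of an operator, as a subspace of `H`. -/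
def operatorNullspace {H K : Type*} [NormedAddCommGroup H] [InnerProductSpace ℂ H]
    [NormedAddCommGroup K] [InnerProductSpace ℂ K] (A : H →ₗ.[ℂ] K) : Submodule ℂ H :=
  (LinearMap.ker A.toFun).map A.domain.subtype

/-- An operator `E` in `H` is a *projection* if `R(E) ⊆ D(E)` and `E (E x) = E x` for every
`x ∈ D(E)`. -/
def IsProjectionOperator {H : Type*} [NormedAddCommGroup H] [InnerProductSpace ℂ H]
    (E : H →ₗ.[ℂ] H) : Prop :=
  ∃ h : ∀ x : E.domain, E x ∈ E.domain, ∀ x : E.domain, E ⟨E x, h x⟩ = E x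

/-!
A subspace of a Hilbert space `G` is semiclosed exactly when it is the range of an injective bounded
operator from some Hilbert space into `G`: the auxiliary inner product turns the subspace itself into
such a Hilbert space (`IsSemiclosedSubspace.exists_injective_range`), and conversely the inner product
of the source can be transported to the range (`isSemiclosedSubspace_of_injective_range`).

Let `E` be a projection. If the graph of `E` is the range of an injective bounded `T : K → H × H`,
then the points of `K` with `snd (T z) = fst (T z)`, and those with `snd (T z) = 0`, form closed
subspaces of `K`. On each of them `fst ∘ T` is injective; its ranges are the set of fixed points of
`E`, which is the range of `E`, and the nullspace of `E`. Conversely, if the range and the nullspace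
are the ranges of injective bounded operators `P` and `Q`, then `(z, w) ↦ (P z + Q w, P z)` is an
injective bounded operator on the Hilbert sum of the two sources, and its range is the graph of `E`,
since `D(E)` is the direct sum of `R(E)` and `N(E)`.
-/

/-- A linear equivalence with a Hilbert space transports the inner product, and the resulting inner
product space is complete. -/
lemma exists_core_of_linearEquiv {S K : Type*} [AddCommGroup S] [Module ℂ S]
    [NormedAddCommGroup K] [InnerProductSpace ℂ K] [CompleteSpace K] (e : S ≃ₗ[ℂ] K) :
    ∃ c : InnerProductSpace.Core ℂ S,
      @CompleteSpace S c.toNormedAddCommGroup.toMetricSpace.toUniformSpace ∧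
      ∀ x : S, RCLike.re (c.inner x x) = ‖e x‖ ^ 2 := by
  let c : InnerProductSpace.Core ℂ S :=
    { inner := fun x y => inner ℂ (e x) (e y)
      conj_inner_symm := fun x y => inner_conj_symm _ _
      re_inner_nonneg := fun x => inner_self_nonneg
      add_left := fun x y z => by simp
      smul_left := fun x y r => by simp [mul_comm]
      definite := fun x hx => by simpa using hx }
  have hc : ∀ x : S, RCLike.re (c.inner x x) = ‖e x‖ ^ 2 := fun x =>
    inner_self_eq_norm_sq (𝕜 := ℂ) (e x)
  refine ⟨c, ?_, hc⟩
  let _ : NormedAddCommGroup S := c.toNormedAddCommGroup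
  have hnorm : ∀ x : S, ‖x‖ = ‖e x‖ := fun x => by
    change √(RCLike.re (c.inner x x)) = _
    rw [hc, Real.sqrt_sq (norm_nonneg _)]
  have hiso : Isometry e := AddMonoidHomClass.isometry_of_norm e fun x => (hnorm x).symm
  exact (completeSpace_congr (e := e.toEquiv) hiso.isUniformEmbedding).2 inferInstance

/-- The range of an injective bounded operator on a Hilbert space is semiclosed. -/
lemma isSemiclosedSubspace_of_injective_range {K G : Type*}
    [NormedAddCommGroup K] [InnerProductSpace ℂ K] [CompleteSpace K]
    [NormedAddCommGroup G] [InnerProductSpace ℂ G] (T : K →L[ℂ] G)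
    (hT : Function.Injective T) {S : Submodule ℂ G} (hS : ∀ y, y ∈ S ↔ ∃ z, T z = y) :
    IsSemiclosedSubspace S := by
  obtain rfl : LinearMap.range T.toLinearMap = S := by
    ext y; simp [hS]
  let e := LinearEquiv.ofInjective T.toLinearMap hT
  obtain ⟨c, hc, hn⟩ := exists_core_of_linearEquiv e.symm
  refine ⟨c, hc, ‖T‖ ^ 2 + 1, by positivity, fun x => ?_⟩
  rw [hn]
  obtain ⟨z, rfl⟩ := e.surjective x
  have h1 : ((e z : LinearMap.range T.toLinearMap) : G) = T z := rfl
  rw [h1, e.symm_apply_apply]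
  calc ‖T z‖ ^ 2 ≤ (‖T‖ * ‖z‖) ^ 2 := by gcongr; exact T.le_opNorm z
    _ ≤ (‖T‖ ^ 2 + 1) * ‖z‖ ^ 2 := by nlinarith [sq_nonneg ‖z‖]

/-- A linear map that is bounded for a complete inner product on its source is a bounded operator
on a Hilbert space. Here the source carries no norm beforehand, so that for a subspace the norm of
the inner product does not compete with the one inherited from the ambient space. -/
lemma exists_continuousLinearMap_of_core.{u} {S : Type u} {G : Type*} [AddCommGroup S] [Module ℂ S]
    [NormedAddCommGroup G] [InnerProductSpace ℂ G] (c : InnerProductSpace.Core ℂ S)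
    (hc : @CompleteSpace S c.toNormedAddCommGroup.toMetricSpace.toUniformSpace)
    (f : S →ₗ[ℂ] G) (b : ℝ) (hb : 0 < b)
    (hf : ∀ x, ‖f x‖ ^ 2 ≤ b * RCLike.re (c.inner x x)) :
    ∃ (K : Type u) (_ : NormedAddCommGroup K) (_ : InnerProductSpace ℂ K) (_ : CompleteSpace K)
      (T : K →L[ℂ] G) (e : K ≃ S), ∀ z, T z = f (e z) := by
  let _ : NormedAddCommGroup S := c.toNormedAddCommGroup
  let _ : InnerProductSpace ℂ S := InnerProductSpace.ofCore c.toCore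
  refine ⟨S, inferInstance, inferInstance, hc, LinearMap.mkContinuous f √b fun x => ?_,
    Equiv.refl S, fun x => rfl⟩
  have h : ‖x‖ = √(RCLike.re (c.inner x x)) := rfl
  rw [h, ← Real.sqrt_mul hb.le]
  exact Real.le_sqrt_of_sq_le (hf x)

/-- A semiclosed subspace is the range of an injective bounded operator on a Hilbert space. -/
lemma IsSemiclosedSubspace.exists_injective_range.{u} {G : Type u} [NormedAddCommGroup G]
    [InnerProductSpace ℂ G] {S : Submodule ℂ G} (hS : IsSemiclosedSubspace S) :
    ∃ (K : Type u) (_ : NormedAddCommGroup K) (_ : InnerProductSpace ℂ K) (_ : CompleteSpace K)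
      (T : K →L[ℂ] G), Function.Injective T ∧ ∀ y, y ∈ S ↔ ∃ z, T z = y := by
  obtain ⟨c, hc, b, hb, h⟩ := hS
  obtain ⟨K, i₁, i₂, i₃, T, e, hT⟩ := exists_continuousLinearMap_of_core c hc S.subtype b hb h
  refine ⟨K, i₁, i₂, i₃, T, fun x y hxy => ?_, fun y => ⟨fun hy => ⟨e.symm ⟨y, hy⟩, ?_⟩, ?_⟩⟩
  · rw [hT, hT] at hxy
    exact e.injective (Subtype.ext hxy)
  · rw [hT, e.apply_symm_apply]
    rfl
  · rintro ⟨z, rfl⟩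
    rw [hT]
    exact (e z).2

section Projection

variable {H K : Type*} [NormedAddCommGroup H] [InnerProductSpace ℂ H]
  [NormedAddCommGroup K] [InnerProductSpace ℂ K]

lemma mem_operatorGraph {A : H →ₗ.[ℂ] K} {p : WithLp 2 (H × K)} :
    p ∈ operatorGraph A ↔ ∃ x : A.domain, (x : H) = p.fst ∧ A x = p.snd :=
  LinearPMap.mem_graph_iff A

lemma mem_operatorRange {A : H →ₗ.[ℂ] K} {y : K} :
    y ∈ operatorRange A ↔ ∃ x : A.domain, A x = y := Iff.rfl

lemma mem_operatorNullspace {A : H →ₗ.[ℂ] K} {x : H} :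
    x ∈ operatorNullspace A ↔ ∃ u : A.domain, (u : H) = x ∧ A u = 0 := by
  simp only [operatorNullspace, Submodule.mem_map, LinearMap.mem_ker, Submodule.subtype_apply]
  exact exists_congr fun u => and_comm

/-- The range of a projection is its set of fixed points. -/
lemma IsProjectionOperator.mem_operatorRange_iff {E : H →ₗ.[ℂ] H} (hE : IsProjectionOperator E)
    {y : H} : y ∈ operatorRange E ↔ ∃ x : E.domain, (x : H) = y ∧ E x = y := by
  obtain ⟨h, hE⟩ := hE
  rw [mem_operatorRange]
  constructor
  · rintro ⟨x, rfl⟩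
    exact ⟨⟨E x, h x⟩, rfl, hE x⟩
  · rintro ⟨x, -, hx⟩
    exact ⟨x, hx⟩

/-- The domain of a projection is the sum of its range and its nullspace, and the projection is the
component in the range. -/
lemma IsProjectionOperator.mem_operatorGraph_iff {E : H →ₗ.[ℂ] H} (hE : IsProjectionOperator E)
    {p : WithLp 2 (H × H)} : p ∈ operatorGraph E ↔
      p.snd ∈ operatorRange E ∧ p.fst - p.snd ∈ operatorNullspace E := by
  rw [mem_operatorGraph, mem_operatorNullspace]
  constructor
  · rintro ⟨x, hx, hx'⟩
    refine ⟨⟨x, hx'⟩, ?_⟩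
    obtain ⟨h, hE⟩ := hE
    refine ⟨x - ⟨E x, h x⟩, ?_, ?_⟩
    · rw [← hx, ← hx']; rfl
    · rw [LinearPMap.map_sub, hE, sub_self]
  · rintro ⟨hr, u, hu, hu'⟩
    obtain ⟨x, hx, hx'⟩ := hE.mem_operatorRange_iff.1 hr
    refine ⟨u + x, ?_, ?_⟩
    · rw [Submodule.coe_add, hu, hx, sub_add_cancel]
    · rw [LinearPMap.map_add, hu', hx', zero_add]

/-- The part of a semiclosed graph on which the operator acts as multiplication by the scalar `r`
projects to a semiclosed subspace: the eigenspaces of a semiclosed operator are semiclosed. -/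
lemma IsSemiclosedOperator.isSemiclosedSubspace_of_eq_smul {A : H →ₗ.[ℂ] H}
    (hA : IsSemiclosedOperator A) (r : ℂ) {S : Submodule ℂ H}
    (hS : ∀ y, y ∈ S ↔ ∃ x : A.domain, (x : H) = y ∧ A x = r • y) :
    IsSemiclosedSubspace S := by
  obtain ⟨L, _, _, _, T, hT, hG⟩ := IsSemiclosedSubspace.exists_injective_range hA
  let F : L →L[ℂ] H := (WithLp.fstL 2 ℂ H H).comp T
  let D : L →L[ℂ] H := (WithLp.sndL 2 ℂ H H).comp T - r • F
  -- The kernel of `D = snd ∘ T - r • fst ∘ T` is closed, hence a Hilbert space.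
  have hD : ∀ z, z ∈ D.ker ↔ (T z).snd = r • (T z).fst := fun z => sub_eq_zero
  have : CompleteSpace D.ker := D.isClosed_ker.completeSpace_coe
  refine isSemiclosedSubspace_of_injective_range (F.comp D.ker.subtypeL) ?_ fun y => ?_
  · rintro ⟨z, hz⟩ ⟨w, hw⟩ hzw
    have h1 : (T z).fst = (T w).fst := hzw
    refine Subtype.ext (hT ((WithLp.equiv 2 (H × H)).injective (Prod.ext h1 ?_)))
    change (T z).snd = (T w).snd
    rw [(hD z).1 hz, (hD w).1 hw, h1]
  · rw [hS]
    constructor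
    · rintro ⟨x, hx, hx'⟩
      obtain ⟨z, hz⟩ := (hG (WithLp.toLp 2 (y, r • y))).1 (mem_operatorGraph.2 ⟨x, hx, hx'⟩)
      have hzD : z ∈ D.ker := (hD z).2 (by rw [hz]; rfl)
      refine ⟨⟨z, hzD⟩, ?_⟩
      change (T z).fst = y
      rw [hz]; rfl
    · rintro ⟨⟨z, hz⟩, rfl⟩
      obtain ⟨x, hx, hx'⟩ := mem_operatorGraph.1 ((hG (T z)).2 ⟨z, rfl⟩)
      exact ⟨x, hx, hx'.trans ((hD z).1 hz)⟩

lemma IsProjectionOperator.isSemiclosedOperator {E : H →ₗ.[ℂ] H} (hE : IsProjectionOperator E)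
    (hR : IsSemiclosedSubspace (operatorRange E))
    (hN : IsSemiclosedSubspace (operatorNullspace E)) : IsSemiclosedOperator E := by
  obtain ⟨L, _, _, _, P, hP, hPR⟩ := hR.exists_injective_range
  obtain ⟨M, _, _, _, Q, hQ, hQN⟩ := hN.exists_injective_range
  let V : WithLp 2 (L × M) →L[ℂ] H := P.comp (WithLp.fstL 2 ℂ L M)
  let W : WithLp 2 (L × M) →L[ℂ] H := Q.comp (WithLp.sndL 2 ℂ L M)
  let T : WithLp 2 (L × M) →L[ℂ] WithLp 2 (H × H) :=
    (WithLp.prodContinuousLinearEquiv 2 ℂ H H).symm.toContinuousLinearMap.comp ((V + W).prod V)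
  have h1 : ∀ z, (T z).fst = P z.fst + Q z.snd := fun z => rfl
  have h2 : ∀ z, (T z).snd = P z.fst := fun z => rfl
  refine isSemiclosedSubspace_of_injective_range T (fun z w hzw => ?_) fun p => ?_
  · have e2 : P z.fst = P w.fst := by rw [← h2, ← h2, hzw]
    have e1 : P z.fst + Q z.snd = P w.fst + Q w.snd := by rw [← h1, ← h1, hzw]
    rw [e2] at e1
    exact (WithLp.equiv 2 (L × M)).injective (Prod.ext (hP e2) (hQ (add_left_cancel e1)))
  · rw [hE.mem_operatorGraph_iff, hPR, hQN]
    constructor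
    · rintro ⟨⟨z, hz⟩, w, hw⟩
      refine ⟨WithLp.toLp 2 (z, w), (WithLp.equiv 2 (H × H)).injective (Prod.ext ?_ hz)⟩
      change P z + Q w = p.fst
      rw [hz, hw, add_sub_cancel]
    · rintro ⟨z, rfl⟩
      exact ⟨⟨z.fst, rfl⟩, z.snd, by rw [h1, h2, add_sub_cancel_left]⟩

end Projection

theorem mainTheorem1 {H : Type*} [NormedAddCommGroup H] [InnerProductSpace ℂ H] [CompleteSpace H]
    (E : H →ₗ.[ℂ] H) (hE : IsProjectionOperator E) :
    IsSemiclosedOperator E ↔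
      IsSemiclosedSubspace (operatorRange E) ∧ IsSemiclosedSubspace (operatorNullspace E) := by
  refine ⟨fun h => ⟨?_, ?_⟩, fun h => hE.isSemiclosedOperator h.1 h.2⟩
  · refine h.isSemiclosedSubspace_of_eq_smul 1 fun y => ?_
    simpa only [one_smul] using hE.mem_operatorRange_iff
  · refine h.isSemiclosedSubspace_of_eq_smul 0 fun y => ?_
    simpa only [zero_smul] using mem_operatorNullspace
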